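/- Let $-\infty<a<b\le+\infty$, let $w>0$ and $p\neq0$ a.e. on $[a,b)$ with $w,1/p,q\in L^1_{loc}[a,b)$, $w$ real, $p,q$ complex-valued, and let $b$ be singular, i.e. $b=+\infty$ or $\int_a^b(w+1/|p|+|q|)\,dx=\infty$. Put $\mathcal M[y]=w^{-1}(-(py')'+qy)$, $[u,v]:=p(uv'-u'v)$, and assume that $Q=\overline{\mathrm{co}}\{q(x)/w(x)+rp(x):x\in[a,b),\,0<r<\infty\}\neq\mathbb C$. Let $\alpha\in\mathbb C$ and let $(\eta,K)\in\mathbb R\times\mathbb C$ be admissible: for some $\lambda_0\in\mathbb C\setminus Q$, $K$ is the nearest point of $Q$ to $\lambda_0$, $\Re[(rp(x)+q(x)/w(x)-K)e^{i\eta}]\ge0$ for all $x\in[a,b)$, $r>0$, and $\Re[(\lambda_0-K)e^{i\eta}]<0$; and moreover $\Re[e^{i\eta}\cos\alpha\,\overline{\sin\alpha}]\le0$. Put $\Lambda_{\eta,K}=\{\lambda:\Re[(\lambda-K)e^{i\eta}]\le0\}$. Suppose that the equation is in Sims Case II or III at $b$: for some $\lambda_1\in\Lambda_{\eta,K}$ all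 solutions of $\mathcal M[y]=\lambda_1y$ lie in $L^2_w[a,b)$ and the condition $$\int_a^b\Re[e^{i\eta}\{p|y'|^2+(q-Kw)|y|^2\}]\,dx+\int_a^b|y|^2w\,dx<\infty$$ is satisfied either by exactly one nontrivial solution up to constant multiples (Case II) or by all solutions (Case III). For $\lambda\in\mathbb C$ let $\theta(\cdot,\lambda),\phi(\cdot,\lambda)$ be the solutions of $\mathcal M[y]=\lambda y$ with $\theta(a,\lambda)=\cos\alpha$, $p\theta'(a,\lambda)=\sin\alpha$, $\phi(a,\lambda)=\sin\alpha$, $p\phi'(a,\lambda)=-\cos\alpha$. Fix $\lambda'\in\Lambda_{\eta,K}$ and a number $m(\lambda')\in\mathbb C$, and let $\psi=\theta(\cdot,\lambda')+m(\lambda')\phi(\cdot,\lambda')$. Let $M$ be the realization of $\mathcal M$ in $L^2_w[a,b)$ with domain given by the boundary conditions $y(a)\cos\alpha+py'(a)\sin\alpha=0$ and $[y,\psi](b)=\lim_{x\to b}[y,\psi](x)=0$. For $\lambda$ not an eigenvalue of $M$ let $m(\lambda)$ be the number for which $\theta(\cdot,\lambda)+m(\lambda)\phi(\cdot,\lambda)$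 lies in $L^2_w[a,b)$ and satisfies the boundary condition at $b$. Let $b_n\in(a,b)$, $b_n\nearrow b$, let $M_n$ be the regular realization of $\mathcal M$ on $[a,b_n]$ with boundary conditions $y(a)\cos\alpha+py'(a)\sin\alpha=0$ and $[y,\psi](b_n)=0$, and for $\lambda$ not an eigenvalue of $M_n$ let $m_n(\lambda)$ be the number with $[\theta(\cdot,\lambda)+m_n(\lambda)\phi(\cdot,\lambda),\psi](b_n)=0$. Then for every compact set $\mathcal K\subset\mathbb C$ containing no eigenvalue of $M$: $m(\lambda)$ exists and is unique for each $\lambda\in\mathcal K$; for all sufficiently large $n$ the set $\mathcal K$ contains no eigenvalue of $M_n$ and $m_n(\lambda)$ exists and is unique for each $\lambda\in\mathcal K$; and $m_n(\lambda)\to m(\lambda)$ as $n\to\infty$, uniformly for $\lambda\in\mathcal K$. -/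

import Mathlib

open MeasureTheory Filter Topology

noncomputable section

/-- A Sturm–Liouville expression `𝓜[y] = w⁻¹ (-(p y')' + q y)` on `[a, b)`, `a ∈ ℝ`, `b ≤ +∞`,
with complex `p, q` and real `w`, regular at `a` and singular at `b`, for which the closed convex
hull of the points `q(x)/w(x) + r p(x)` is not the whole plane. As `w > 0` is only assumed almost
everywhere, the hull is taken over those `x` at which the quotient makes sense. -/
structure SturmLiouville where
  a : ℝ
  b : EReal
  a_lt_b : (a : EReal) < b
  p : ℝ → ℂ
  q : ℝ → ℂ
  w : ℝ → ℝ
  w_pos : ∀ᵐ x ∂(volume.restrict {x : ℝ | a ≤ x ∧ (x : EReal) < b}), 0 < w x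
  p_ne : ∀ᵐ x ∂(volume.restrict {x : ℝ | a ≤ x ∧ (x : EReal) < b}), p x ≠ 0
  w_loc : LocallyIntegrableOn w {x : ℝ | a ≤ x ∧ (x : EReal) < b}
  p_loc : LocallyIntegrableOn (fun x => (p x)⁻¹) {x : ℝ | a ≤ x ∧ (x : EReal) < b}
  q_loc : LocallyIntegrableOn q {x : ℝ | a ≤ x ∧ (x : EReal) < b}
  hull_ne : closure (convexHull ℝ {z : ℂ | ∃ x : ℝ, (a ≤ x ∧ (x : EReal) < b) ∧ 0 < w x ∧
    ∃ r : ℝ, 0 < r ∧ z = q x / w x + r * p x}) ≠ Set.univ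
  singular : b = ⊤ ∨ ∫⁻ x in {x : ℝ | a ≤ x ∧ (x : EReal) < b},
    ENNReal.ofReal (w x + ‖p x‖⁻¹ + ‖q x‖) = ⊤

namespace SturmLiouville

variable (P : SturmLiouville)

/-- The interval `[a, b)`. -/
def I : Set ℝ := {x : ℝ | P.a ≤ x ∧ (x : EReal) < P.b}

/-- The set `Q`, the closed convex hull of all `q(x)/w(x) + r p(x)`, `x ∈ [a, b)`, `r > 0`. -/
def Q : Set ℂ := closure (convexHull ℝ {z : ℂ | ∃ x : ℝ, x ∈ P.I ∧ 0 < P.w x ∧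
    ∃ r : ℝ, 0 < r ∧ z = P.q x / P.w x + r * P.p x})

/-- `(η, K) ∈ S`: for some `lam₀ ∉ Q`, `K` is the nearest point of `Q` to `lam₀`, and after the
translation by `-K` and the rotation by `η` the set `Q` lies in the closed right half plane and
`lam₀` in the open left half plane. -/
def Admissible (η : ℝ) (K : ℂ) : Prop :=
  ∃ lam₀ : ℂ, lam₀ ∉ P.Q ∧ K ∈ P.Q ∧ (∀ z ∈ P.Q, dist lam₀ K ≤ dist lam₀ z) ∧
    (∀ x ∈ P.I, 0 < P.w x → ∀ r : ℝ, 0 < r →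
      0 ≤ ((r * P.p x + P.q x / P.w x - K) * Complex.exp (Complex.I * η)).re) ∧
    ((lam₀ - K) * Complex.exp (Complex.I * η)).re < 0

/-- `(η, K) ∈ S(α)`. -/
def AdmissibleAt (α : ℂ) (η : ℝ) (K : ℂ) : Prop :=
  P.Admissible η K ∧
    (Complex.exp (Complex.I * η) * Complex.cos α * starRingEnd ℂ (Complex.sin α)).re ≤ 0

/-- Functions are carried together with their quasi-derivative: `Y x = (y x, (p y') x)`.
`P.HasImage J Y f` says that, on the interval `J` with left end point `a`, both `y` and `p y'` are
locally absolutely continuous and `𝓜[y] = f`, i.e. `-(p y')' + q y = w f` almost everywhere. -/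
def HasImage (J : Set ℝ) (Y : ℝ → ℂ × ℂ) (f : ℝ → ℂ) : Prop :=
  (∀ c ∈ J, AbsolutelyContinuousOnInterval (fun x => (Y x).1) P.a c) ∧
  (∀ c ∈ J, AbsolutelyContinuousOnInterval (fun x => (Y x).2) P.a c) ∧
  (∀ᵐ x ∂(volume.restrict J), HasDerivAt (fun t => (Y t).1) ((Y x).2 / P.p x) x) ∧
  (∀ᵐ x ∂(volume.restrict J),
    HasDerivAt (fun t => (Y t).2) (P.q x * (Y x).1 - P.w x * f x) x)

/-- `Y = (y, p y')` is a solution of `𝓜[y] = lam y` on `[a, b)`. -/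
def IsSolution (lam : ℂ) (Y : ℝ → ℂ × ℂ) : Prop :=
  P.HasImage P.I Y (fun x => lam * (Y x).1)

/-- Membership in the weighted space `L²_w(J)`. -/
def L2w (J : Set ℝ) (f : ℝ → ℂ) : Prop :=
  AEStronglyMeasurable f (volume.restrict J) ∧ IntegrableOn (fun x => P.w x * ‖f x‖ ^ 2) J

/-- The condition `∫ Re[e^{iη} (p |y'|² + (q - K w) |y|²)] + ∫ |y|² w < ∞` over `[a, b)`, for
`Y = (y, p y')`. For admissible `(η, K)` both integrands are nonnegative almost everywhere. -/
def FiniteEnergy (η : ℝ) (K : ℂ) (Y : ℝ → ℂ × ℂ) : Prop :=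
  IntegrableOn (fun x => (Complex.exp (Complex.I * η) *
    (P.p x * (‖(Y x).2 / P.p x‖ ^ 2 : ℝ) + (P.q x - K * P.w x) * (‖(Y x).1‖ ^ 2 : ℝ))).re) P.I ∧
  P.L2w P.I (fun x => (Y x).1)

/-- Sims Case II (observed at the spectral parameter `lam`): up to constant multiples exactly one
nontrivial solution has finite energy, but all solutions lie in `L²_w`. -/
def SimsCaseII (η : ℝ) (K lam : ℂ) : Prop :=
  (∃ Y, P.IsSolution lam Y ∧ (∃ x ∈ P.I, (Y x).1 ≠ 0) ∧ P.FiniteEnergy η K Y ∧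
    ∀ Z, P.IsSolution lam Z → P.FiniteEnergy η K Z →
      ∃ c : ℂ, ∀ x ∈ P.I, (Z x).1 = c * (Y x).1) ∧
  ∀ Y, P.IsSolution lam Y → P.L2w P.I (fun x => (Y x).1)

/-- Sims Case III (observed at the spectral parameter `lam`): all solutions lie in `L²_w` and have
finite energy. -/
def SimsCaseIII (η : ℝ) (K lam : ℂ) : Prop :=
  ∀ Y, P.IsSolution lam Y → P.L2w P.I (fun x => (Y x).1) ∧ P.FiniteEnergy η K Y

/-- The filter `x → b` from within the real line, `x < b`. -/
def atEnd : Filter ℝ := comap (fun x : ℝ => (x : EReal)) (𝓝[<] P.b)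

/-- `y` belongs to the domain of `M` and `M y = f`. Here `M` is the realization of `𝓜` in
`L²_w[a, b)` with the boundary conditions `y(a) cos α + (p y')(a) sin α = 0` and
`[y, ψ](b) = lim_{x → b} [y, ψ](x) = 0`. -/
def opM (α : ℂ) (ψ Y : ℝ → ℂ × ℂ) (f : ℝ → ℂ) : Prop :=
  P.HasImage P.I Y f ∧ P.L2w P.I (fun x => (Y x).1) ∧ P.L2w P.I f ∧
  (Y P.a).1 * Complex.cos α + (Y P.a).2 * Complex.sin α = 0 ∧
  Tendsto (fun x => (Y x).1 * (ψ x).2 - (Y x).2 * (ψ x).1) P.atEnd (𝓝 0)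

/-- `y` belongs to the domain of the regular operator on `[a, c]` with the boundary conditions
`y(a) cos α + (p y')(a) sin α = 0` and `[y, ψ](c) = 0`, and is mapped to `f`. -/
def opReg (α : ℂ) (ψ : ℝ → ℂ × ℂ) (c : ℝ) (Y : ℝ → ℂ × ℂ) (f : ℝ → ℂ) : Prop :=
  P.HasImage (Set.Icc P.a c) Y f ∧ P.L2w (Set.Icc P.a c) (fun x => (Y x).1) ∧
  P.L2w (Set.Icc P.a c) f ∧
  (Y P.a).1 * Complex.cos α + (Y P.a).2 * Complex.sin α = 0 ∧
  (Y c).1 * (ψ c).2 - (Y c).2 * (ψ c).1 = 0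

/-- `lam` is an eigenvalue of `M`. -/
def IsEigenvalueM (α : ℂ) (ψ : ℝ → ℂ × ℂ) (lam : ℂ) : Prop :=
  ∃ Y, P.opM α ψ Y (fun x => lam * (Y x).1) ∧ ∃ x ∈ P.I, (Y x).1 ≠ 0

/-- `lam` is an eigenvalue of the regular operator on `[a, c]`. -/
def IsEigenvalueReg (α : ℂ) (ψ : ℝ → ℂ × ℂ) (c : ℝ) (lam : ℂ) : Prop :=
  ∃ Y, P.opReg α ψ c Y (fun x => lam * (Y x).1) ∧ ∃ x ∈ Set.Icc P.a c, (Y x).1 ≠ 0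

/-- `μ` is the value at a point of the Titchmarsh–Weyl function of `M`, where `Θ, Φ` are the
solutions `θ, φ` at that point: `θ + μ φ` lies in `L²_w[a, b)` and `[θ + μ φ, ψ](b) = 0`. -/
def IsWeylValue (ψ Θ Φ : ℝ → ℂ × ℂ) (μ : ℂ) : Prop :=
  P.L2w P.I (fun x => ((Θ + μ • Φ) x).1) ∧
  Tendsto (fun x => ((Θ + μ • Φ) x).1 * (ψ x).2 - ((Θ + μ • Φ) x).2 * (ψ x).1) P.atEnd (𝓝 0)

end SturmLiouville

/-- `μ` is the value at a point of the Titchmarsh–Weyl function of the regular operator on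
`[a, c]`: `[θ + μ φ, ψ](c) = 0`. -/
def IsRegWeylValue (ψ Θ Φ : ℝ → ℂ × ℂ) (c : ℝ) (μ : ℂ) : Prop :=
  ((Θ + μ • Φ) c).1 * (ψ c).2 - ((Θ + μ • Φ) c).2 * (ψ c).1 = 0

end

/-!
Write `[y, z]` for the Wronskian. Since all solutions for one parameter `lam₁` lie in `L²_w`, the
end point `b` is in the limit-circle case: expanding a solution for another parameter `lam` in a
fundamental system at `lam₁`, its coefficients satisfy a linear integral inequality with integrable
kernel, and Grönwall's inequality bounds all solutions with `lam` in a bounded set by one function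
in `L²_w`.

By Lagrange's identity, `[y, z](x)` is a constant plus `lam - mu` times `∫ w y z` over `[a, x]`, if
`y` and `z` are solutions for `lam` and `mu`. Together with the common majorant this gives
`[y, z](x) → [y, z](b)` uniformly for bounded `lam`, and, via the Plücker identity among the
Wronskians of four functions, continuity of the limit in `lam`.

Finally `m_n = -[θ, ψ](b_n) / [φ, ψ](b_n)` and `m = -[θ, ψ](b) / [φ, ψ](b)`, where zeros of the
denominators are eigenvalues, so that on a compact set without eigenvalues the denominators stay
away from zero and the quotients converge uniformly.
-/

section AbsolutelyContinuous

theorem absolutelyContinuousOnInterval_of_dist_le {X Y : Type*} [PseudoMetricSpace X]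
    [PseudoMetricSpace Y] {f : ℝ → X} {g : ℝ → Y} {a b C : ℝ}
    (hg : AbsolutelyContinuousOnInterval g a b)
    (hfg : ∀ x ∈ Set.uIcc a b, ∀ y ∈ Set.uIcc a b, dist (f x) (f y) ≤ C * dist (g x) (g y)) :
    AbsolutelyContinuousOnInterval f a b := by
  unfold AbsolutelyContinuousOnInterval at *
  refine squeeze_zero' (Eventually.of_forall fun _ => Finset.sum_nonneg fun _ _ => dist_nonneg) ?_
    (by simpa using hg.const_mul C)
  refine eventually_inf_principal.2 (Eventually.of_forall fun E hE => ?_)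
  rw [Finset.mul_sum]
  exact Finset.sum_le_sum fun i hi => hfg _ (hE.1 i hi).1 _ (hE.1 i hi).2

theorem absolutelyContinuousOnInterval_comp_of_contDiff {E F : Type*} [NormedAddCommGroup E]
    [NormedSpace ℝ E] [ProperSpace E] [NormedAddCommGroup F] [NormedSpace ℝ F] {φ : E → F}
    {f : ℝ → E} {a b : ℝ} (hφ : ContDiff ℝ 1 φ) (hf : AbsolutelyContinuousOnInterval f a b) :
    AbsolutelyContinuousOnInterval (fun x => φ (f x)) a b := by
  obtain ⟨R, hR⟩ := hf.exists_bound
  obtain ⟨C, hC⟩ := hφ.contDiffOn.exists_lipschitzOnWith one_ne_zero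
    (convex_closedBall (0 : E) R) (isCompact_closedBall 0 R)
  exact absolutelyContinuousOnInterval_of_dist_le hf fun x hx y hy =>
    hC.dist_le_mul _ (mem_closedBall_zero_iff.2 (hR x hx)) _ (mem_closedBall_zero_iff.2 (hR y hy))

theorem absolutelyContinuousOnInterval_intervalIntegral {E : Type*} [NormedAddCommGroup E]
    [NormedSpace ℝ E] {f : ℝ → E} {a b c : ℝ} (hf : IntervalIntegrable f volume a b)
    (hc : c ∈ Set.uIcc a b) :
    AbsolutelyContinuousOnInterval (fun x => ∫ t in c..x, f t) a b := by
  refine absolutelyContinuousOnInterval_of_dist_le (C := 1)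
    (hf.norm.absolutelyContinuousOnInterval_intervalIntegral hc) fun x hx y hy => ?_
  have hfx := hf.mono_set (Set.uIcc_subset_uIcc hc hx)
  have hfy := hf.mono_set (Set.uIcc_subset_uIcc hc hy)
  rw [one_mul, dist_eq_norm, dist_eq_norm,
    intervalIntegral.integral_interval_sub_left hfx hfy,
    intervalIntegral.integral_interval_sub_left hfx.norm hfy.norm, Real.norm_eq_abs]
  exact intervalIntegral.norm_integral_le_abs_integral_norm

theorem intervalIntegral_eq_sub_of_absolutelyContinuousOnInterval {E : Type*}
    [NormedAddCommGroup E] [NormedSpace ℝ E] [CompleteSpace E] {f f' : ℝ → E} {a b : ℝ}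
    (hf : AbsolutelyContinuousOnInterval f a b)
    (hderiv : ∀ᵐ x, x ∈ Set.uIcc a b → HasDerivAt f (f' x) x)
    (hint : IntervalIntegrable f' volume a b) : ∫ x in a..b, f' x = f b - f a := by
  have hsub : AbsolutelyContinuousOnInterval (fun x => f x - ∫ t in a..x, f' t) a b :=
    hf.fun_sub (absolutelyContinuousOnInterval_intervalIntegral hint Set.left_mem_uIcc)
  have hsub' : ∀ᵐ x, x ∈ Set.uIcc a b → HasDerivAt (fun x => f x - ∫ t in a..x, f' t) 0 x := by
    filter_upwards [hderiv, hint.ae_hasDerivAt_integral] with x hfx hintx hx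
    simpa only [sub_self] using! (hfx hx).fun_sub (hintx hx a Set.left_mem_uIcc)
  obtain ⟨C, hC⟩ := hsub.const_of_ae_hasDerivAt_zero hsub'
  have ha := hC a Set.left_mem_uIcc
  rw [intervalIntegral.integral_same, sub_zero] at ha
  rw [ha, ← hC b Set.right_mem_uIcc, sub_sub_cancel]

theorem le_mul_exp_integral_of_le_add_integral {g k : ℝ → ℝ} {a b g₀ : ℝ} (hab : a ≤ b)
    (hk : IntervalIntegrable k volume a b) (hk0 : ∀ x ∈ Set.Icc a b, 0 ≤ k x)
    (hg : ContinuousOn g (Set.Icc a b))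
    (hle : ∀ x ∈ Set.Icc a b, g x ≤ g₀ + ∫ t in a..x, k t * g t) :
    g b ≤ g₀ * Real.exp (∫ t in a..b, k t) := by
  rw [← Set.uIcc_of_le hab] at hk0 hg hle
  have hkg : IntervalIntegrable (fun t => k t * g t) volume a b := hk.mul_continuousOn hg
  set S : ℝ → ℝ := fun x => ∫ t in a..x, k t with hS
  set H : ℝ → ℝ := fun x => g₀ + ∫ t in a..x, k t * g t with hH
  have hS_ac : AbsolutelyContinuousOnInterval S a b :=
    hk.absolutelyContinuousOnInterval_intervalIntegral Set.left_mem_uIcc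
  have hH_ac : AbsolutelyContinuousOnInterval H a b :=
    absolutelyContinuousOnInterval_comp_of_contDiff (contDiff_const.add contDiff_id)
      (hkg.absolutelyContinuousOnInterval_intervalIntegral Set.left_mem_uIcc)
  have hHS_ac : AbsolutelyContinuousOnInterval (fun x => H x * Real.exp (-S x)) a b :=
    hH_ac.fun_mul (absolutelyContinuousOnInterval_comp_of_contDiff
      (φ := fun s => Real.exp (-s)) (by fun_prop) hS_ac)
  have hderiv : ∀ᵐ x, x ∈ Set.uIcc a b → deriv (fun x => H x * Real.exp (-S x)) x ≤ 0 := by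
    filter_upwards [hk.ae_hasDerivAt_integral, hkg.ae_hasDerivAt_integral] with x hSx hHx hx
    have hHS := ((hHx hx a Set.left_mem_uIcc).const_add g₀).mul
      (hSx hx a Set.left_mem_uIcc).neg.exp
    rw [show deriv (fun x => H x * Real.exp (-S x)) x = -(k x * (H x - g x) * Real.exp (-S x)) from
      hHS.deriv.trans (by simp only [hH, hS, Pi.neg_apply]; ring), neg_nonpos]
    exact mul_nonneg (mul_nonneg (hk0 x hx) (sub_nonneg.2 (hle x hx))) (Real.exp_pos _).le
  have hdecr : H b * Real.exp (-S b) - H a * Real.exp (-S a) ≤ 0 := by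
    rw [← hHS_ac.integral_deriv_eq_sub, intervalIntegral.integral_of_le hab]
    rw [Set.uIcc_of_le hab] at hderiv
    exact integral_nonpos_of_ae ((ae_restrict_iff' measurableSet_Ioc).2
      (hderiv.mono fun x hx hx' => hx (Set.Ioc_subset_Icc_self hx')))
  have hHb : H b * Real.exp (-S b) ≤ g₀ := by simpa [hS, hH] using hdecr
  rw [Real.exp_neg, ← div_eq_mul_inv, div_le_iff₀ (Real.exp_pos _)] at hHb
  exact (hle b Set.right_mem_uIcc).trans hHb

end AbsolutelyContinuous

theorem eventually_forall_ne_zero_of_tendstoUniformlyOn {X ι E : Type*} [TopologicalSpace X]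
    [NormedAddCommGroup E] {f : ι → X → E} {F : X → E} {l : Filter ι} {s : Set X}
    (hf : TendstoUniformlyOn f F l s) (hs : IsCompact s) (hF : ContinuousOn F s)
    (hF0 : ∀ x ∈ s, F x ≠ 0) : ∀ᶠ i in l, ∀ x ∈ s, f i x ≠ 0 := by
  obtain ⟨ε, hε, hεF⟩ : ∃ ε > 0, ∀ x ∈ s, ε ≤ ‖F x‖ :=
    hs.exists_forall_le' hF.norm fun x hx => norm_pos_iff.2 (hF0 x hx)
  filter_upwards [Metric.tendstoUniformlyOn_iff.1 hf ε hε] with i hi x hx h0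
  exact (hεF x hx).not_gt (by simpa [h0] using hi x hx)

namespace SturmLiouville

/-- The bilinear form `[y, z] = p (y z' - y' z)`, for functions carried with their
quasi-derivatives. -/
def wronskian (Y Z : ℝ → ℂ × ℂ) (x : ℝ) : ℂ := (Y x).1 * (Z x).2 - (Y x).2 * (Z x).1

section Wronskian

variable (U V Y Z : ℝ → ℂ × ℂ) (x : ℝ)

theorem fst_mul_wronskian : (Y x).1 * wronskian U V x =
    (U x).1 * wronskian Y V x - (V x).1 * wronskian Y U x := by
  unfold wronskian; ring

theorem wronskian_mul_wronskian : wronskian Y Z x * wronskian U V x =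
    wronskian Y V x * wronskian U Z x - wronskian Y U x * wronskian V Z x := by
  unfold wronskian; ring

theorem wronskian_add_smul_left (c : ℂ) :
    wronskian (U + c • V) Y x = wronskian U Y x + c * wronskian V Y x := by
  simp only [wronskian, Pi.add_apply, Pi.smul_apply, Prod.fst_add, Prod.snd_add, Prod.smul_fst,
    Prod.smul_snd, smul_eq_mul]
  ring

variable {x} in
theorem norm_fst_le_of_wronskian_ne_zero (hUV : wronskian U V x ≠ 0) :
    ‖(Y x).1‖ ≤ ‖wronskian U V x‖⁻¹ *
      ((‖wronskian Y V x‖ + ‖wronskian Y U x‖) * (‖(U x).1‖ + ‖(V x).1‖)) := by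
  have hnorm : ‖(Y x).1‖ * ‖wronskian U V x‖ ≤
      ‖(U x).1‖ * ‖wronskian Y V x‖ + ‖(V x).1‖ * ‖wronskian Y U x‖ := by
    rw [← norm_mul, fst_mul_wronskian, ← norm_mul, ← norm_mul]
    exact norm_sub_le _ _
  rw [inv_mul_eq_div, le_div_iff₀ (norm_pos_iff.2 hUV)]
  refine hnorm.trans (le_of_sub_nonneg ?_)
  calc (0 : ℝ) ≤ ‖wronskian Y V x‖ * ‖(V x).1‖ + ‖wronskian Y U x‖ * ‖(U x).1‖ := by positivity
    _ = _ := by ring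

theorem norm_wronskian_le : ‖wronskian Y Z x‖ ≤ 2 * (‖Y x‖ * ‖Z x‖) :=
  calc ‖wronskian Y Z x‖ ≤ ‖(Y x).1‖ * ‖(Z x).2‖ + ‖(Y x).2‖ * ‖(Z x).1‖ := by
        simpa only [wronskian, norm_mul] using norm_sub_le ((Y x).1 * (Z x).2) ((Y x).2 * (Z x).1)
    _ ≤ ‖Y x‖ * ‖Z x‖ + ‖Y x‖ * ‖Z x‖ := by
        gcongr <;> first | exact norm_fst_le _ | exact norm_snd_le _
    _ = 2 * (‖Y x‖ * ‖Z x‖) := by ring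

end Wronskian

variable {P : SturmLiouville}

section Interval

theorem left_mem_I : P.a ∈ P.I := ⟨le_rfl, P.a_lt_b⟩

theorem Icc_subset_I {c : ℝ} (hc : c ∈ P.I) : Set.Icc P.a c ⊆ P.I := fun _ hx =>
  ⟨hx.1, (EReal.coe_le_coe_iff.2 hx.2).trans_lt hc.2⟩

theorem uIcc_subset_I {c : ℝ} (hc : c ∈ P.I) : Set.uIcc P.a c ⊆ P.I := by
  rw [Set.uIcc_of_le hc.1]
  exact Icc_subset_I hc

theorem Ioc_subset_I {c : ℝ} (hc : c ∈ P.I) : Set.Ioc P.a c ⊆ P.I :=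
  Set.Ioc_subset_Icc_self.trans (Icc_subset_I hc)

theorem measurableSet_I : MeasurableSet P.I :=
  measurableSet_Ici.inter (measurable_coe_real_ereal measurableSet_Iio)

theorem exists_gt_mem_I {x : ℝ} (hx : x ∈ P.I) : ∃ c ∈ P.I, x < c := by
  obtain ⟨c, hxc, hcb⟩ := EReal.lt_iff_exists_real_btwn.1 hx.2
  have hxc := EReal.coe_lt_coe_iff.1 hxc
  exact ⟨c, ⟨hx.1.trans hxc.le, hcb⟩, hxc⟩

instance atEnd_neBot : P.atEnd.NeBot := by
  refine comap_neBot fun t ht => ?_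
  obtain ⟨l, hl, hlt⟩ := (mem_nhdsLT_iff_exists_Ioo_subset' P.a_lt_b).1 ht
  obtain ⟨c, hlc, hcb⟩ := EReal.lt_iff_exists_real_btwn.1 hl
  exact ⟨c, hlt ⟨hlc, hcb⟩⟩

instance atEnd_isCountablyGenerated : P.atEnd.IsCountablyGenerated := by
  unfold atEnd; infer_instance

theorem eventually_atEnd_mem {c : ℝ} (hc : c ∈ P.I) : ∀ᶠ x in P.atEnd, x ∈ P.I ∧ c < x := by
  filter_upwards [preimage_mem_comap (Ioo_mem_nhdsLT hc.2)] with x hx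
  have hcx := EReal.coe_lt_coe_iff.1 hx.1
  exact ⟨⟨hc.1.trans hcx.le, hx.2⟩, hcx⟩

theorem tendsto_atEnd {ι : Type*} {l : Filter ι} {u : ι → ℝ} (hu : ∀ i, (u i : EReal) < P.b)
    (hlim : Tendsto (fun i => (u i : EReal)) l (𝓝 P.b)) : Tendsto u l P.atEnd :=
  tendsto_comap_iff.2 (tendsto_nhdsWithin_iff.2 ⟨hlim, Eventually.of_forall hu⟩)

theorem continuousOn_I {X : Type*} [TopologicalSpace X] {f : ℝ → X}
    (hf : ∀ c ∈ P.I, ContinuousOn f (Set.Icc P.a c)) : ContinuousOn f P.I := by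
  intro x hx
  obtain ⟨c, hc, hxc⟩ := exists_gt_mem_I hx
  exact (hf c hc x ⟨hx.1, hxc.le⟩).mono_of_mem_nhdsWithin
    (mem_nhdsWithin.2 ⟨Set.Iio c, isOpen_Iio, hxc, fun y hy => ⟨hy.2.1, hy.1.le⟩⟩)

theorem intervalIntegrable_w {x : ℝ} (hx : x ∈ P.I) : IntervalIntegrable P.w volume P.a x :=
  (P.w_loc.integrableOn_compact_subset (uIcc_subset_I hx) isCompact_uIcc).intervalIntegrable

theorem intervalIntegral_le_setIntegral_I {f : ℝ → ℝ} (hf : IntegrableOn f P.I)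
    (hf0 : ∀ t, 0 ≤ f t) {x : ℝ} (hx : x ∈ P.I) : ∫ t in P.a..x, f t ≤ ∫ t in P.I, f t := by
  rw [intervalIntegral.integral_of_le hx.1]
  exact setIntegral_mono_set hf (Eventually.of_forall hf0) (Ioc_subset_I hx).eventuallyLE

variable {E : Type*} [NormedAddCommGroup E] [NormedSpace ℝ E] {f : ℝ → E}

theorem norm_setIntegral_sub_intervalIntegral_le {g : ℝ → ℝ} (hf : IntegrableOn f P.I)
    (hg : IntegrableOn g P.I) (hfg : ∀ t ∈ P.I, ‖f t‖ ≤ g t) {x : ℝ} (hx : x ∈ P.I) :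
    ‖(∫ t in P.I, f t) - ∫ t in P.a..x, f t‖ ≤ (∫ t in P.I, g t) - ∫ t in P.a..x, g t := by
  rw [intervalIntegral.integral_of_le hx.1, intervalIntegral.integral_of_le hx.1,
    ← setIntegral_sdiff measurableSet_Ioc hf (Ioc_subset_I hx),
    ← setIntegral_sdiff measurableSet_Ioc hg (Ioc_subset_I hx)]
  exact norm_integral_le_of_norm_le (hg.mono_set Set.sdiff_subset)
    (ae_restrict_of_forall_mem (measurableSet_I.diff measurableSet_Ioc) fun t ht => hfg t ht.1)

theorem tendsto_intervalIntegral_atEnd (hf : IntegrableOn f P.I) :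
    Tendsto (fun x => ∫ t in P.a..x, f t) P.atEnd (𝓝 (∫ t in P.I, f t)) := by
  have hcover : AECover (volume.restrict P.I) P.atEnd fun x => Set.Ioc P.a x :=
    { ae_eventually_mem := by
        filter_upwards [ae_restrict_mem measurableSet_I,
          ae_restrict_of_ae (measure_eq_zero_iff_ae_notMem.1 (Real.volume_singleton (a := P.a)))]
          with t ht hta
        filter_upwards [eventually_atEnd_mem ht] with x hx
        exact ⟨lt_of_le_of_ne ht.1 (Ne.symm hta), hx.2.le⟩
      measurableSet := fun x => measurableSet_Ioc }
  refine (hcover.integral_tendsto_of_countably_generated hf).congr' ?_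
  filter_upwards [eventually_atEnd_mem left_mem_I] with x hx
  rw [intervalIntegral.integral_of_le hx.1.1, Measure.restrict_restrict_of_subset
    (Ioc_subset_I hx.1)]

end Interval

section HasImage

variable {J J' : Set ℝ} {Y Z : ℝ → ℂ × ℂ} {f g : ℝ → ℂ}

theorem HasImage.mono (hY : P.HasImage J Y f) (h : J' ⊆ J) : P.HasImage J' Y f :=
  ⟨fun c hc => hY.1 c (h hc), fun c hc => hY.2.1 c (h hc),
    ae_restrict_of_ae_restrict_of_subset h hY.2.2.1,
    ae_restrict_of_ae_restrict_of_subset h hY.2.2.2⟩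

theorem HasImage.integral_eq_wronskian_sub {c : ℝ} (hac : P.a ≤ c)
    (hY : P.HasImage (Set.Icc P.a c) Y f) (hZ : P.HasImage (Set.Icc P.a c) Z g)
    (hint : IntervalIntegrable (fun x => P.w x * (f x * (Z x).1 - (Y x).1 * g x)) volume P.a c) :
    ∫ x in P.a..c, P.w x * (f x * (Z x).1 - (Y x).1 * g x) =
      wronskian Y Z c - wronskian Y Z P.a := by
  have hc : c ∈ Set.Icc P.a c := ⟨hac, le_rfl⟩
  refine intervalIntegral_eq_sub_of_absolutelyContinuousOnInterval
    (((hY.1 c hc).fun_smul (hZ.2.1 c hc)).fun_sub ((hY.2.1 c hc).fun_smul (hZ.1 c hc))) ?_ hint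
  rw [Set.uIcc_of_le hac, ← ae_restrict_iff' measurableSet_Icc]
  filter_upwards [hY.2.2.1, hY.2.2.2, hZ.2.2.1, hZ.2.2.2] with x hy hpy hz hpz
  exact ((hy.mul hpz).sub (hpy.mul hz)).congr_deriv (by ring)

theorem HasImage.wronskian_eq {lam : ℂ} {c : ℝ} (hac : P.a ≤ c)
    (hY : P.HasImage (Set.Icc P.a c) Y fun x => lam * (Y x).1)
    (hZ : P.HasImage (Set.Icc P.a c) Z fun x => lam * (Z x).1) :
    wronskian Y Z c = wronskian Y Z P.a := by
  have hzero : (fun x => (P.w x : ℂ) * (lam * (Y x).1 * (Z x).1 - (Y x).1 * (lam * (Z x).1))) =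
      fun _ => 0 := by
    ext x; ring
  have hgreen := hY.integral_eq_wronskian_sub hac hZ (hzero ▸ intervalIntegrable_const)
  rw [hzero, intervalIntegral.integral_zero] at hgreen
  exact (sub_eq_zero.1 hgreen.symm)

end HasImage

section Solution

variable {U V Y Z : ℝ → ℂ × ℂ} {lam mu : ℂ} {x : ℝ}

theorem IsSolution.continuousOn_fst (hY : P.IsSolution lam Y) :
    ContinuousOn (fun x => (Y x).1) P.I :=
  continuousOn_I fun c hc => Set.uIcc_of_le hc.1 ▸ (hY.1 c hc).continuousOn

theorem IsSolution.continuousOn_snd (hY : P.IsSolution lam Y) :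
    ContinuousOn (fun x => (Y x).2) P.I :=
  continuousOn_I fun c hc => Set.uIcc_of_le hc.1 ▸ (hY.2.1 c hc).continuousOn

theorem IsSolution.continuousOn_wronskian (hY : P.IsSolution lam Y) (hZ : P.IsSolution mu Z) :
    ContinuousOn (wronskian Y Z) P.I :=
  (hY.continuousOn_fst.mul hZ.continuousOn_snd).sub (hY.continuousOn_snd.mul hZ.continuousOn_fst)

theorem IsSolution.add_smul (hY : P.IsSolution lam Y) (hZ : P.IsSolution lam Z) (c : ℂ) :
    P.IsSolution lam (Y + c • Z) := by
  refine ⟨fun d hd => (hY.1 d hd).fun_add ((hZ.1 d hd).const_smul c),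
    fun d hd => (hY.2.1 d hd).fun_add ((hZ.2.1 d hd).const_smul c), ?_, ?_⟩
  · filter_upwards [hY.2.2.1, hZ.2.2.1] with x hy hz
    refine (hy.add (hz.const_smul c)).congr_deriv ?_
    simp only [Pi.add_apply, Pi.smul_apply, Prod.snd_add, Prod.smul_snd, smul_eq_mul]
    ring
  · filter_upwards [hY.2.2.2, hZ.2.2.2] with x hy hz
    refine (hy.add (hz.const_smul c)).congr_deriv ?_
    simp only [Pi.add_apply, Pi.smul_apply, Prod.fst_add, Prod.smul_fst, smul_eq_mul]
    ring

theorem IsSolution.apply_left_eq_zero (hY : P.IsSolution lam Y)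
    (hzero : ∀ x ∈ P.I, (Y x).1 = 0) : Y P.a = 0 := by
  obtain ⟨c, hc, hac⟩ := exists_gt_mem_I (left_mem_I (P := P))
  have hsub : Set.Ioo P.a c ⊆ P.I := Set.Ioo_subset_Icc_self.trans (Icc_subset_I hc)
  have hsnd : (fun x => (Y x).2) =ᵐ[volume.restrict (Set.Ioo P.a c)] fun _ => 0 := by
    filter_upwards [ae_restrict_of_ae_restrict_of_subset hsub hY.2.2.1,
      ae_restrict_of_ae_restrict_of_subset hsub P.p_ne, ae_restrict_mem measurableSet_Ioo]
      with x hderiv hpx hx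
    have hderiv_zero : HasDerivAt (fun t => (Y t).1) 0 x := by
      refine (hasDerivAt_const x (0 : ℂ)).congr_of_eventuallyEq ?_
      filter_upwards [Ioo_mem_nhds hx.1 hx.2] with t ht using hzero t (hsub ht)
    exact (div_eq_zero_iff.1 (hderiv.unique hderiv_zero)).resolve_right hpx
  rw [restrict_Ioo_eq_restrict_Icc] at hsnd
  exact Prod.ext (hzero _ left_mem_I) (Measure.eqOn_Icc_of_ae_eq volume hac.ne hsnd
    (hY.continuousOn_snd.mono (Icc_subset_I hc)) continuousOn_const ⟨le_rfl, hac.le⟩)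

theorem IsSolution.wronskian_eq_add_integral (hY : P.IsSolution lam Y) (hZ : P.IsSolution mu Z)
    (hx : x ∈ P.I) : wronskian Y Z x =
      wronskian Y Z P.a + (lam - mu) * ∫ t in P.a..x, P.w t * ((Y t).1 * (Z t).1) := by
  have hdensity : (fun t => (P.w t : ℂ) * (lam * (Y t).1 * (Z t).1 - (Y t).1 * (mu * (Z t).1))) =
      fun t => (lam - mu) * (P.w t * ((Y t).1 * (Z t).1)) := by
    ext t; ring
  have hint : IntervalIntegrable (fun t => P.w t * ((Y t).1 * (Z t).1)) volume P.a x :=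
    IntervalIntegrable.mul_continuousOn
      ⟨(intervalIntegrable_w hx).1.ofReal, (intervalIntegrable_w hx).2.ofReal⟩
      ((hY.continuousOn_fst.mul hZ.continuousOn_fst).mono (uIcc_subset_I hx))
  have hgreen := HasImage.integral_eq_wronskian_sub hx.1 (HasImage.mono hY (Icc_subset_I hx))
    (HasImage.mono hZ (Icc_subset_I hx)) (hdensity ▸ hint.const_mul (lam - mu))
  rw [hdensity, intervalIntegral.integral_const_mul] at hgreen
  rw [hgreen, add_sub_cancel]

theorem IsSolution.norm_wronskian_le_add_integral (hY : P.IsSolution lam Y) (hZ : P.IsSolution mu Z)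
    (hx : x ∈ P.I) : ‖wronskian Y Z x‖ ≤ ‖wronskian Y Z P.a‖ +
      ‖lam - mu‖ * ∫ t in P.a..x, |P.w t| * (‖(Y t).1‖ * ‖(Z t).1‖) := by
  rw [hY.wronskian_eq_add_integral hZ hx]
  refine (norm_add_le _ _).trans ?_
  rw [norm_mul]
  gcongr
  refine (intervalIntegral.norm_integral_le_integral_norm hx.1).trans_eq ?_
  simp only [norm_mul, Complex.norm_real, Real.norm_eq_abs]

/-- Two solutions of `𝓜[y] = lam y` whose Wronskian, which is constant, does not vanish. -/
structure IsFundamentalSystem (P : SturmLiouville) (lam : ℂ) (U V : ℝ → ℂ × ℂ) : Prop where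
  left : P.IsSolution lam U
  right : P.IsSolution lam V
  wronskian_ne_zero : wronskian U V P.a ≠ 0

theorem IsFundamentalSystem.wronskian_eq (hUV : P.IsFundamentalSystem lam U V) (hx : x ∈ P.I) :
    wronskian U V x = wronskian U V P.a := by
  rw [hUV.left.wronskian_eq_add_integral hUV.right hx, sub_self, zero_mul, add_zero]

theorem IsFundamentalSystem.norm_fst_le_mul_norm_wronskian_add
    (hUV : P.IsFundamentalSystem lam U V) (Y : ℝ → ℂ × ℂ) (hx : x ∈ P.I) :
    ‖(Y x).1‖ ≤ ‖wronskian U V P.a‖⁻¹ *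
      ((‖wronskian Y V x‖ + ‖wronskian Y U x‖) * (‖(U x).1‖ + ‖(V x).1‖)) :=
  hUV.wronskian_eq hx ▸ norm_fst_le_of_wronskian_ne_zero U V Y
    ((hUV.wronskian_eq hx).trans_ne hUV.wronskian_ne_zero)

/-- A choice, for every spectral parameter, of the solution with initial values
`(y(a), (p y')(a)) = y₀`. -/
def IsSolutionFamily (P : SturmLiouville) (y₀ : ℂ × ℂ) (Y : ℂ → ℝ → ℂ × ℂ) : Prop :=
  ∀ lam, P.IsSolution lam (Y lam) ∧ Y lam P.a = y₀

end Solution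

section Majorant

variable {U V Y : ℝ → ℂ × ℂ} {lam lam₁ mu : ℂ} {x : ℝ}

/-- The density `|w| (|u| + |v|)²` of a pair of functions; up to constants it is the kernel of the
integral inequality satisfied by the coefficients in the variation of constants. -/
noncomputable def pairDensity (P : SturmLiouville) (U V : ℝ → ℂ × ℂ) (x : ℝ) : ℝ :=
  |P.w x| * (‖(U x).1‖ + ‖(V x).1‖) ^ 2

theorem pairDensity_nonneg (U V : ℝ → ℂ × ℂ) (x : ℝ) : 0 ≤ P.pairDensity U V x := by
  unfold pairDensity; positivity

theorem integrableOn_pairDensity (hU : P.L2w P.I fun x => (U x).1)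
    (hV : P.L2w P.I fun x => (V x).1) : IntegrableOn (P.pairDensity U V) P.I := by
  refine ((hU.2.norm.add hV.2.norm).const_mul 2).mono'
    (P.w_loc.aestronglyMeasurable.norm.mul ((hU.1.norm.add hV.1.norm).pow 2))
    (Eventually.of_forall fun x => ?_)
  rw [Real.norm_of_nonneg (pairDensity_nonneg U V x)]
  simp only [Pi.add_apply, norm_mul, norm_pow, Real.norm_eq_abs, abs_norm]
  calc |P.w x| * (‖(U x).1‖ + ‖(V x).1‖) ^ 2
      ≤ |P.w x| * (2 * (‖(U x).1‖ ^ 2 + ‖(V x).1‖ ^ 2)) := by gcongr; exact add_sq_le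
    _ = 2 * (|P.w x| * ‖(U x).1‖ ^ 2 + |P.w x| * ‖(V x).1‖ ^ 2) := by ring

theorem IsSolution.intervalIntegrable_pairDensity (hU : P.IsSolution lam U)
    (hV : P.IsSolution mu V) (hx : x ∈ P.I) :
    IntervalIntegrable (P.pairDensity U V) volume P.a x :=
  (intervalIntegrable_w hx).norm.mul_continuousOn
    (((hU.continuousOn_fst.norm.add hV.continuousOn_fst.norm).pow 2).mono (uIcc_subset_I hx))

theorem IsFundamentalSystem.norm_wronskian_add_le_add_integral
    (hUV : P.IsFundamentalSystem lam₁ U V) (hY : P.IsSolution lam Y) (hx : x ∈ P.I) :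
    ‖wronskian Y V x‖ + ‖wronskian Y U x‖ ≤ ‖wronskian Y V P.a‖ + ‖wronskian Y U P.a‖ +
      ∫ t in P.a..x, ‖lam - lam₁‖ * ‖wronskian U V P.a‖⁻¹ * P.pairDensity U V t *
        (‖wronskian Y V t‖ + ‖wronskian Y U t‖) := by
  have hint {Z : ℝ → ℂ × ℂ} (hZ : P.IsSolution lam₁ Z) : IntervalIntegrable
      (fun t => |P.w t| * (‖(Y t).1‖ * ‖(Z t).1‖)) volume P.a x :=
    (intervalIntegrable_w hx).norm.mul_continuousOn
      ((hY.continuousOn_fst.norm.mul hZ.continuousOn_fst.norm).mono (uIcc_subset_I hx))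
  have hkernel : IntervalIntegrable (fun t => ‖lam - lam₁‖ * ‖wronskian U V P.a‖⁻¹ *
      P.pairDensity U V t * (‖wronskian Y V t‖ + ‖wronskian Y U t‖)) volume P.a x :=
    ((hUV.left.intervalIntegrable_pairDensity hUV.right hx).const_mul _).mul_continuousOn
      (((hY.continuousOn_wronskian hUV.right).norm.add
        (hY.continuousOn_wronskian hUV.left).norm).mono (uIcc_subset_I hx))
  have hmono : ∫ t in P.a..x, ‖lam - lam₁‖ *
        (|P.w t| * (‖(Y t).1‖ * ‖(V t).1‖) + |P.w t| * (‖(Y t).1‖ * ‖(U t).1‖)) ≤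
      ∫ t in P.a..x, ‖lam - lam₁‖ * ‖wronskian U V P.a‖⁻¹ * P.pairDensity U V t *
        (‖wronskian Y V t‖ + ‖wronskian Y U t‖) := by
    refine intervalIntegral.integral_mono_on hx.1
      (((hint hUV.right).add (hint hUV.left)).const_mul _) hkernel fun t ht => ?_
    calc _ = ‖lam - lam₁‖ * (|P.w t| * (‖(Y t).1‖ * (‖(U t).1‖ + ‖(V t).1‖))) := by ring
      _ ≤ ‖lam - lam₁‖ * (|P.w t| * (‖wronskian U V P.a‖⁻¹ *
            ((‖wronskian Y V t‖ + ‖wronskian Y U t‖) * (‖(U t).1‖ + ‖(V t).1‖)) *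
            (‖(U t).1‖ + ‖(V t).1‖))) := by
          gcongr
          exact hUV.norm_fst_le_mul_norm_wronskian_add Y (Icc_subset_I hx ht)
      _ = _ := by unfold pairDensity; ring
  rw [intervalIntegral.integral_const_mul,
    intervalIntegral.integral_add (hint hUV.right) (hint hUV.left)] at hmono
  linarith [hY.norm_wronskian_le_add_integral hUV.right hx,
    hY.norm_wronskian_le_add_integral hUV.left hx]

theorem IsFundamentalSystem.norm_wronskian_add_le (hUV : P.IsFundamentalSystem lam₁ U V)
    (hY : P.IsSolution lam Y) (hx : x ∈ P.I) :
    ‖wronskian Y V x‖ + ‖wronskian Y U x‖ ≤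
      (‖wronskian Y V P.a‖ + ‖wronskian Y U P.a‖) * Real.exp (∫ t in P.a..x,
        ‖lam - lam₁‖ * ‖wronskian U V P.a‖⁻¹ * P.pairDensity U V t) :=
  le_mul_exp_integral_of_le_add_integral hx.1
    ((hUV.left.intervalIntegrable_pairDensity hUV.right hx).const_mul _)
    (fun t _ => mul_nonneg (by positivity) (pairDensity_nonneg U V t))
    (((hY.continuousOn_wronskian hUV.right).norm.add
      (hY.continuousOn_wronskian hUV.left).norm).mono (Icc_subset_I hx))
    fun _ ht => hUV.norm_wronskian_add_le_add_integral hY (Icc_subset_I hx ht)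

/-- `h` is square integrable with weight `w` and dominates, up to the size of their initial values,
all solutions of `𝓜[y] = lam y` with `lam ∈ B`. -/
def IsMajorant (P : SturmLiouville) (B : Set ℂ) (h : ℝ → ℝ) : Prop :=
  IntegrableOn (fun x => |P.w x| * h x ^ 2) P.I ∧
    ∀ lam ∈ B, ∀ Y, P.IsSolution lam Y → ∀ x ∈ P.I, ‖(Y x).1‖ ≤ ‖Y P.a‖ * h x

/-- The limit-circle case at `b`, in a form uniform in the spectral parameter: the solutions have a
common majorant in `L²_w` as long as the parameter stays bounded. -/
def UniformLimitCircle (P : SturmLiouville) : Prop :=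
  ∀ B : Set ℂ, Bornology.IsBounded B → ∃ h, P.IsMajorant B h

theorem IsFundamentalSystem.norm_fst_le (hUV : P.IsFundamentalSystem lam₁ U V)
    (hint : IntegrableOn (P.pairDensity U V) P.I) (hY : P.IsSolution lam Y) (hx : x ∈ P.I) :
    ‖(Y x).1‖ ≤ ‖Y P.a‖ * (2 * ‖wronskian U V P.a‖⁻¹ * (‖U P.a‖ + ‖V P.a‖) *
      Real.exp (‖lam - lam₁‖ * ‖wronskian U V P.a‖⁻¹ * ∫ t in P.I, P.pairDensity U V t) *
        (‖(U x).1‖ + ‖(V x).1‖)) := by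
  have hgrowth := hUV.norm_wronskian_add_le hY hx
  rw [intervalIntegral.integral_const_mul] at hgrowth
  have hintegral := intervalIntegral_le_setIntegral_I hint (pairDensity_nonneg U V) hx
  have hinit : ‖wronskian Y V P.a‖ + ‖wronskian Y U P.a‖ ≤
      2 * (‖Y P.a‖ * (‖U P.a‖ + ‖V P.a‖)) := by
    linarith [norm_wronskian_le Y V P.a, norm_wronskian_le Y U P.a]
  calc ‖(Y x).1‖ ≤ ‖wronskian U V P.a‖⁻¹ * ((2 * (‖Y P.a‖ * (‖U P.a‖ + ‖V P.a‖)) *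
        Real.exp (‖lam - lam₁‖ * ‖wronskian U V P.a‖⁻¹ * ∫ t in P.I, P.pairDensity U V t)) *
        (‖(U x).1‖ + ‖(V x).1‖)) := by
        refine (hUV.norm_fst_le_mul_norm_wronskian_add Y hx).trans ?_
        gcongr
        exact hgrowth.trans (by gcongr)
    _ = _ := by ring

theorem IsFundamentalSystem.uniformLimitCircle (hUV : P.IsFundamentalSystem lam₁ U V)
    (hU : P.L2w P.I fun x => (U x).1) (hV : P.L2w P.I fun x => (V x).1) :
    P.UniformLimitCircle := by
  intro B hB
  have hint := integrableOn_pairDensity hU hV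
  obtain ⟨R, hR⟩ := hB.subset_closedBall lam₁
  set C : ℝ → ℝ := fun r => 2 * ‖wronskian U V P.a‖⁻¹ * (‖U P.a‖ + ‖V P.a‖) *
    Real.exp (r * ‖wronskian U V P.a‖⁻¹ * ∫ t in P.I, P.pairDensity U V t) with hC
  refine ⟨fun x => C R * (‖(U x).1‖ + ‖(V x).1‖), ?_, fun lam hlam Y hY x hx => ?_⟩
  · simpa only [mul_pow, mul_left_comm, pairDensity] using! hint.const_mul (C R ^ 2)
  · have hlamR : ‖lam - lam₁‖ ≤ R := mem_closedBall_iff_norm.1 (hR hlam)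
    have hpos : 0 ≤ ∫ t in P.I, P.pairDensity U V t := integral_nonneg (pairDensity_nonneg U V)
    calc ‖(Y x).1‖ ≤ ‖Y P.a‖ * (C ‖lam - lam₁‖ * (‖(U x).1‖ + ‖(V x).1‖)) :=
          hUV.norm_fst_le hint hY hx
      _ ≤ ‖Y P.a‖ * (C R * (‖(U x).1‖ + ‖(V x).1‖)) := by
          simp only [hC]
          gcongr

end Majorant

section Endpoint

variable {B : Set ℂ} {h : ℝ → ℝ} {U V Y Z ψ : ℝ → ℂ × ℂ} {lam lam' mu : ℂ} {x : ℝ}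

theorem IsMajorant.norm_w_mul_le (hB : P.IsMajorant B h) (hlam : lam ∈ B)
    (hY : P.IsSolution lam Y) (hmu : mu ∈ B) (hZ : P.IsSolution mu Z) (hx : x ∈ P.I) :
    ‖P.w x * ((Y x).1 * (Z x).1)‖ ≤ ‖Y P.a‖ * ‖Z P.a‖ * (|P.w x| * h x ^ 2) := by
  have hYx := hB.2 lam hlam Y hY x hx
  have hZx := hB.2 mu hmu Z hZ x hx
  rw [norm_mul, norm_mul, Complex.norm_real, Real.norm_eq_abs]
  calc |P.w x| * (‖(Y x).1‖ * ‖(Z x).1‖)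
      ≤ |P.w x| * ((‖Y P.a‖ * h x) * (‖Z P.a‖ * h x)) := by
        gcongr
        exact (norm_nonneg _).trans hYx
    _ = ‖Y P.a‖ * ‖Z P.a‖ * (|P.w x| * h x ^ 2) := by ring

theorem IsMajorant.integrableOn_w_mul (hB : P.IsMajorant B h) (hlam : lam ∈ B)
    (hY : P.IsSolution lam Y) (hmu : mu ∈ B) (hZ : P.IsSolution mu Z) :
    IntegrableOn (fun t => P.w t * ((Y t).1 * (Z t).1)) P.I :=
  (hB.1.const_mul (‖Y P.a‖ * ‖Z P.a‖)).mono'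
    ((Complex.continuous_ofReal.comp_aestronglyMeasurable P.w_loc.aestronglyMeasurable).mul
      ((hY.continuousOn_fst.mul hZ.continuousOn_fst).aestronglyMeasurable measurableSet_I))
    (ae_restrict_of_forall_mem measurableSet_I fun _ ht => hB.norm_w_mul_le hlam hY hmu hZ ht)

theorem IsMajorant.norm_setIntegral_w_mul_le (hB : P.IsMajorant B h) (hlam : lam ∈ B)
    (hY : P.IsSolution lam Y) (hmu : mu ∈ B) (hZ : P.IsSolution mu Z) :
    ‖∫ t in P.I, P.w t * ((Y t).1 * (Z t).1)‖ ≤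
      ‖Y P.a‖ * ‖Z P.a‖ * ∫ t in P.I, |P.w t| * h t ^ 2 := by
  rw [← integral_const_mul]
  exact norm_integral_le_of_norm_le (hB.1.const_mul _)
    (ae_restrict_of_forall_mem measurableSet_I fun _ ht => hB.norm_w_mul_le hlam hY hmu hZ ht)

theorem UniformLimitCircle.l2w (hP : P.UniformLimitCircle) (hY : P.IsSolution lam Y) :
    P.L2w P.I fun x => (Y x).1 := by
  obtain ⟨h, hB⟩ := hP {lam} Bornology.isBounded_singleton
  have hmeas := hY.continuousOn_fst.aestronglyMeasurable (μ := volume) measurableSet_I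
  refine ⟨hmeas, (hB.integrableOn_w_mul rfl hY rfl hY).norm.mono'
    (P.w_loc.aestronglyMeasurable.mul (hmeas.norm.pow 2)) (Eventually.of_forall fun x => ?_)⟩
  simp only [norm_mul, norm_norm, Complex.norm_real, pow_two, le_refl]

/-- The boundary value `[y, z](b) = lim_{x → b} [y, z](x)`, a junk value if the limit does not
exist. -/
noncomputable def wronskianAtEnd (P : SturmLiouville) (Y Z : ℝ → ℂ × ℂ) : ℂ :=
  limUnder P.atEnd (wronskian Y Z)

theorem UniformLimitCircle.tendsto_wronskian_setIntegral (hP : P.UniformLimitCircle)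
    (hY : P.IsSolution lam Y) (hZ : P.IsSolution mu Z) :
    Tendsto (wronskian Y Z) P.atEnd
      (𝓝 (wronskian Y Z P.a + (lam - mu) * ∫ t in P.I, P.w t * ((Y t).1 * (Z t).1))) := by
  obtain ⟨h, hB⟩ := hP {lam, mu} (Set.toFinite _).isBounded
  have hint := hB.integrableOn_w_mul (Or.inl rfl) hY (Or.inr rfl) hZ
  refine (((tendsto_intervalIntegral_atEnd hint).const_mul (lam - mu)).const_add _).congr' ?_
  filter_upwards [eventually_atEnd_mem left_mem_I] with x hx
  exact (hY.wronskian_eq_add_integral hZ hx.1).symm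

theorem UniformLimitCircle.wronskianAtEnd_eq (hP : P.UniformLimitCircle)
    (hY : P.IsSolution lam Y) (hZ : P.IsSolution mu Z) : P.wronskianAtEnd Y Z =
      wronskian Y Z P.a + (lam - mu) * ∫ t in P.I, P.w t * ((Y t).1 * (Z t).1) :=
  (hP.tendsto_wronskian_setIntegral hY hZ).limUnder_eq

theorem UniformLimitCircle.tendsto_wronskian (hP : P.UniformLimitCircle)
    (hY : P.IsSolution lam Y) (hZ : P.IsSolution mu Z) :
    Tendsto (wronskian Y Z) P.atEnd (𝓝 (P.wronskianAtEnd Y Z)) :=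
  tendsto_nhds_limUnder ⟨_, hP.tendsto_wronskian_setIntegral hY hZ⟩

theorem IsMajorant.norm_wronskianAtEnd_sub_le (hP : P.UniformLimitCircle)
    (hB : P.IsMajorant B h) (hlam : lam ∈ B) (hY : P.IsSolution lam Y) (hmu : mu ∈ B)
    (hZ : P.IsSolution mu Z) (hx : x ∈ P.I) :
    ‖P.wronskianAtEnd Y Z - wronskian Y Z x‖ ≤ ‖lam - mu‖ * (‖Y P.a‖ * ‖Z P.a‖) *
      ((∫ t in P.I, |P.w t| * h t ^ 2) - ∫ t in P.a..x, |P.w t| * h t ^ 2) := by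
  rw [hP.wronskianAtEnd_eq hY hZ, hY.wronskian_eq_add_integral hZ hx, add_sub_add_left_eq_sub,
    ← mul_sub, norm_mul, mul_assoc, mul_sub, ← integral_const_mul,
    ← intervalIntegral.integral_const_mul]
  gcongr
  exact norm_setIntegral_sub_intervalIntegral_le (hB.integrableOn_w_mul hlam hY hmu hZ)
    (hB.1.const_mul _) (fun t ht => hB.norm_w_mul_le hlam hY hmu hZ ht) hx

theorem UniformLimitCircle.tendstoUniformlyOn_wronskian (hP : P.UniformLimitCircle)
    (hB : Bornology.IsBounded B) {y₀ : ℂ × ℂ} {Y : ℂ → ℝ → ℂ × ℂ} (hY : P.IsSolutionFamily y₀ Y)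
    (hψ : P.IsSolution lam' ψ) :
    TendstoUniformlyOn (fun x lam => wronskian (Y lam) ψ x)
      (fun lam => P.wronskianAtEnd (Y lam) ψ) P.atEnd B := by
  obtain ⟨h, hmaj⟩ := hP (insert lam' B) (hB.insert lam')
  obtain ⟨R, hR⟩ := hB.subset_closedBall lam'
  have htail : Tendsto (fun x => R * (‖y₀‖ * ‖ψ P.a‖) *
      ((∫ t in P.I, |P.w t| * h t ^ 2) - ∫ t in P.a..x, |P.w t| * h t ^ 2)) P.atEnd (𝓝 0) := by
    rw [← mul_zero (R * (‖y₀‖ * ‖ψ P.a‖)), ← sub_self (∫ t in P.I, |P.w t| * h t ^ 2)]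
    exact ((tendsto_intervalIntegral_atEnd hmaj.1).const_sub _).const_mul _
  refine Metric.tendstoUniformlyOn_iff.2 fun ε hε => ?_
  filter_upwards [htail.eventually_lt_const hε, eventually_atEnd_mem left_mem_I]
    with x hxε hx lam hlam
  have hRlam : ‖lam - lam'‖ ≤ R := mem_closedBall_iff_norm.1 (hR hlam)
  have hle := hmaj.norm_wronskianAtEnd_sub_le hP (Or.inr hlam) (hY lam).1 (Or.inl rfl) hψ hx.1
  have htail_nonneg := sub_nonneg.2 (intervalIntegral_le_setIntegral_I hmaj.1
    (fun t => mul_nonneg (abs_nonneg (P.w t)) (sq_nonneg (h t))) hx.1)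
  rw [(hY lam).2] at hle
  rw [dist_eq_norm]
  exact lt_of_le_of_lt (hle.trans (by gcongr)) hxε

theorem UniformLimitCircle.continuousAt_wronskianAtEnd_of_isSolution
    (hP : P.UniformLimitCircle) {y₀ : ℂ × ℂ} {Y : ℂ → ℝ → ℂ × ℂ} (hY : P.IsSolutionFamily y₀ Y)
    (hZ : P.IsSolution mu Z) : ContinuousAt (fun lam => P.wronskianAtEnd (Y lam) Z) mu := by
  obtain ⟨h, hB⟩ := hP (Metric.closedBall mu 1) Metric.isBounded_closedBall
  have hbound : Tendsto (fun lam => ‖lam - mu‖ *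
      (‖y₀‖ * ‖Z P.a‖ * ∫ t in P.I, |P.w t| * h t ^ 2)) (𝓝 mu) (𝓝 0) := by
    simpa only [sub_self, norm_zero, zero_mul] using
      ((continuous_sub_right mu).norm.mul_const _).tendsto mu
  refine tendsto_iff_norm_sub_tendsto_zero.2 (squeeze_zero' (Eventually.of_forall fun _ =>
    norm_nonneg _) ?_ hbound)
  filter_upwards [Metric.closedBall_mem_nhds mu one_pos] with lam hlam
  have hinit : wronskian (Y lam) Z P.a = wronskian (Y mu) Z P.a := by
    simp only [wronskian, (hY _).2]
  rw [hP.wronskianAtEnd_eq (hY lam).1 hZ, hP.wronskianAtEnd_eq (hY mu).1 hZ, hinit, sub_self,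
    zero_mul, add_zero, add_sub_cancel_left, norm_mul, ← (hY lam).2]
  gcongr
  exact hB.norm_setIntegral_w_mul_le hlam (hY lam).1 (Metric.mem_closedBall_self zero_le_one) hZ

theorem UniformLimitCircle.wronskianAtEnd_mul (hP : P.UniformLimitCircle)
    (hUV : P.IsFundamentalSystem mu U V) (hY : P.IsSolution lam Y) (hZ : P.IsSolution lam' Z) :
    P.wronskianAtEnd Y Z * wronskian U V P.a =
      P.wronskianAtEnd Y V * P.wronskianAtEnd U Z -
        P.wronskianAtEnd Y U * P.wronskianAtEnd V Z := by
  refine tendsto_nhds_unique ((hP.tendsto_wronskian hY hZ).mul_const _) ?_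
  refine (((hP.tendsto_wronskian hY hUV.right).mul (hP.tendsto_wronskian hUV.left hZ)).sub
    ((hP.tendsto_wronskian hY hUV.left).mul (hP.tendsto_wronskian hUV.right hZ))).congr' ?_
  filter_upwards [eventually_atEnd_mem left_mem_I] with x hx
  rw [← hUV.wronskian_eq hx.1, wronskian_mul_wronskian U V Y Z]

-- As the parameter of `ψ` is fixed, its boundary form is expanded in those of a fundamental
-- system at `mu`, for which the factor `lam - mu` in Lagrange's identity gives the continuity.
theorem UniformLimitCircle.continuousAt_wronskianAtEnd (hP : P.UniformLimitCircle)
    (hUV : P.IsFundamentalSystem mu U V) {y₀ : ℂ × ℂ} {Y : ℂ → ℝ → ℂ × ℂ}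
    (hY : P.IsSolutionFamily y₀ Y) (hψ : P.IsSolution lam' ψ) :
    ContinuousAt (fun lam => P.wronskianAtEnd (Y lam) ψ) mu := by
  have hplucker : (fun lam => P.wronskianAtEnd (Y lam) ψ) = fun lam =>
      (P.wronskianAtEnd (Y lam) V * P.wronskianAtEnd U ψ -
        P.wronskianAtEnd (Y lam) U * P.wronskianAtEnd V ψ) / wronskian U V P.a :=
    funext fun lam => eq_div_of_mul_eq hUV.wronskian_ne_zero
      (hP.wronskianAtEnd_mul hUV (hY lam).1 hψ)
  rw [hplucker]
  exact (((hP.continuousAt_wronskianAtEnd_of_isSolution hY hUV.right).mul_const _).sub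
    ((hP.continuousAt_wronskianAtEnd_of_isSolution hY hUV.left).mul_const _)).div_const _

end Endpoint

section Weyl

variable {α lam lam' : ℂ} {Θ Φ ψ : ℝ → ℂ × ℂ} {c : ℝ}

theorem isFundamentalSystem_of_apply_left (hΘ : P.IsSolution lam Θ) (hΦ : P.IsSolution lam Φ)
    (hΘ_left : Θ P.a = (Complex.cos α, Complex.sin α))
    (hΦ_left : Φ P.a = (Complex.sin α, -Complex.cos α)) : P.IsFundamentalSystem lam Θ Φ where
  left := hΘ
  right := hΦ
  wronskian_ne_zero := by
    have hwronskian : wronskian Θ Φ P.a = -1 := by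
      simp only [wronskian, hΘ_left, hΦ_left]
      linear_combination -Complex.sin_sq_add_cos_sq α
    exact hwronskian.trans_ne (neg_ne_zero.2 one_ne_zero)

theorem isRegWeylValue_iff (hΦ : wronskian Φ ψ c ≠ 0) (μ : ℂ) :
    IsRegWeylValue ψ Θ Φ c μ ↔ μ = -(wronskian Θ ψ c / wronskian Φ ψ c) := by
  change wronskian (Θ + μ • Φ) ψ c = 0 ↔ _
  rw [wronskian_add_smul_left, ← neg_div, eq_div_iff hΦ, add_comm, add_eq_zero_iff_eq_neg]

theorem UniformLimitCircle.isWeylValue_iff (hP : P.UniformLimitCircle)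
    (hΘ : P.IsSolution lam Θ) (hΦ : P.IsSolution lam Φ) (hψ : P.IsSolution lam' ψ)
    (hne : P.wronskianAtEnd Φ ψ ≠ 0) (μ : ℂ) :
    P.IsWeylValue ψ Θ Φ μ ↔ μ = -(P.wronskianAtEnd Θ ψ / P.wronskianAtEnd Φ ψ) := by
  have hlim : Tendsto (wronskian (Θ + μ • Φ) ψ) P.atEnd
      (𝓝 (P.wronskianAtEnd Θ ψ + μ * P.wronskianAtEnd Φ ψ)) :=
    ((hP.tendsto_wronskian hΘ hψ).add ((hP.tendsto_wronskian hΦ hψ).const_mul μ)).congr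
      fun x => (wronskian_add_smul_left Θ Φ ψ x μ).symm
  rw [← neg_div, eq_div_iff hne, ← add_eq_zero_iff_eq_neg, add_comm]
  exact ⟨fun h => tendsto_nhds_unique hlim h.2,
    fun h => ⟨hP.l2w (hΘ.add_smul hΦ μ), h ▸ hlim⟩⟩

theorem UniformLimitCircle.isEigenvalueM_of_wronskianAtEnd_eq_zero (hP : P.UniformLimitCircle)
    (hΦ : P.IsSolution lam Φ) (hΦ_left : Φ P.a = (Complex.sin α, -Complex.cos α))
    (hψ : P.IsSolution lam' ψ) (hzero : P.wronskianAtEnd Φ ψ = 0) : P.IsEigenvalueM α ψ lam := by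
  have hL2 := hP.l2w hΦ
  refine ⟨Φ, ⟨hΦ, hL2, ⟨hL2.1.const_mul lam, ?_⟩, ?_, hzero ▸ hP.tendsto_wronskian hΦ hψ⟩, ?_⟩
  · simpa only [norm_mul, mul_pow, mul_left_comm] using! hL2.2.const_mul (‖lam‖ ^ 2)
  · rw [hΦ_left]
    ring
  · by_contra! hvanish
    have hΦ_zero := hΦ.apply_left_eq_zero hvanish
    rw [hΦ_left, Prod.mk_eq_zero, neg_eq_zero] at hΦ_zero
    simpa [hΦ_zero.1, hΦ_zero.2] using Complex.sin_sq_add_cos_sq α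

theorem IsFundamentalSystem.wronskian_eq_zero_of_isEigenvalueReg
    (hΘΦ : P.IsFundamentalSystem lam Θ Φ) (hΦ_left : Φ P.a = (Complex.sin α, -Complex.cos α))
    (hc : c ∈ P.I) (heig : P.IsEigenvalueReg α ψ c lam) : wronskian Φ ψ c = 0 := by
  obtain ⟨Y, ⟨hY, -, -, hYa, hYc⟩, x, hx, hYx⟩ := heig
  have hconst {t : ℝ} (ht : t ∈ Set.Icc P.a c) {Z : ℝ → ℂ × ℂ} (hZ : P.IsSolution lam Z) :
      wronskian Y Z t = wronskian Y Z P.a :=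
    (hY.mono (Set.Icc_subset_Icc_right ht.2)).wronskian_eq ht.1
      (HasImage.mono hZ (Icc_subset_I (Icc_subset_I hc ht)))
  have hcI : c ∈ Set.Icc P.a c := ⟨hc.1, le_rfl⟩
  have hYΦ : wronskian Y Φ P.a = 0 := by
    simp only [wronskian, hΦ_left]
    linear_combination -hYa
  have hYΘ : wronskian Y Θ P.a ≠ 0 := by
    intro hYΘ
    have hYx' := fst_mul_wronskian Θ Φ Y x
    rw [hconst hx hΘΦ.left, hconst hx hΘΦ.right, hYΦ, hYΘ, mul_zero, mul_zero, sub_zero,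
      hΘΦ.wronskian_eq (Icc_subset_I hc hx)] at hYx'
    exact (mul_ne_zero hYx hΘΦ.wronskian_ne_zero) hYx'
  have hplucker := wronskian_mul_wronskian Θ Φ Y ψ c
  rw [hconst hcI hΘΦ.left, hconst hcI hΘΦ.right, hYΦ, show wronskian Y ψ c = 0 from hYc, zero_mul,
    zero_mul, zero_sub, eq_comm, neg_eq_zero] at hplucker
  exact (mul_eq_zero.1 hplucker).resolve_left hYΘ

theorem UniformLimitCircle.tendstoUniformlyOn_wronskian_div (hP : P.UniformLimitCircle)
    {y₀ z₀ : ℂ × ℂ} {θ φ : ℂ → ℝ → ℂ × ℂ} (hθ : P.IsSolutionFamily y₀ θ)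
    (hφ : P.IsSolutionFamily z₀ φ) (hθφ : ∀ lam, P.IsFundamentalSystem lam (θ lam) (φ lam))
    (hψ : P.IsSolution lam' ψ) {𝒦 : Set ℂ} (h𝒦 : IsCompact 𝒦)
    (hne : ∀ lam ∈ 𝒦, P.wronskianAtEnd (φ lam) ψ ≠ 0) :
    TendstoUniformlyOn (fun x lam => -(wronskian (θ lam) ψ x / wronskian (φ lam) ψ x))
      (fun lam => -(P.wronskianAtEnd (θ lam) ψ / P.wronskianAtEnd (φ lam) ψ)) P.atEnd 𝒦 := by
  have hcont {u₀ : ℂ × ℂ} {Y : ℂ → ℝ → ℂ × ℂ} (hY : P.IsSolutionFamily u₀ Y) :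
      ContinuousOn (fun lam => P.wronskianAtEnd (Y lam) ψ) 𝒦 := fun lam _ =>
    (hP.continuousAt_wronskianAtEnd (hθφ lam) hY hψ).continuousWithinAt
  have hdiv := (hP.tendstoUniformlyOn_wronskian h𝒦.isBounded hθ hψ).tendstoLocallyUniformlyOn.div₀
    (hP.tendstoUniformlyOn_wronskian h𝒦.isBounded hφ hψ).tendstoLocallyUniformlyOn
    (hcont hθ) (hcont hφ) hne
  exact ((tendstoLocallyUniformlyOn_iff_tendstoUniformlyOn_of_compact h𝒦).1 hdiv).neg

end Weyl

end SturmLiouville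

open SturmLiouville

theorem mainTheorem7_general {ι : Type*} {l : Filter ι} (P : SturmLiouville) (α lam₁ : ℂ)
    (hlam₁ : ∀ Y, P.IsSolution lam₁ Y → P.L2w P.I fun x => (Y x).1)
    (θ φ : ℂ → ℝ → ℂ × ℂ)
    (hθ : ∀ lam, P.IsSolution lam (θ lam) ∧ θ lam P.a = (Complex.cos α, Complex.sin α))
    (hφ : ∀ lam, P.IsSolution lam (φ lam) ∧ φ lam P.a = (Complex.sin α, -Complex.cos α))
    (lam' : ℂ) (ψ : ℝ → ℂ × ℂ) (hψ : P.IsSolution lam' ψ) (m : ℂ → ℂ)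
    (hm : ∀ lam, ¬ P.IsEigenvalueM α ψ lam → P.IsWeylValue ψ (θ lam) (φ lam) (m lam))
    (bn : ι → ℝ) (hbn : Tendsto bn l P.atEnd) (mn : ι → ℂ → ℂ)
    (hmn : ∀ᶠ n in l, ∀ lam, ¬ P.IsEigenvalueReg α ψ (bn n) lam →
      IsRegWeylValue ψ (θ lam) (φ lam) (bn n) (mn n lam))
    (𝒦 : Set ℂ) (h𝒦 : IsCompact 𝒦) (h𝒦_eig : ∀ lam ∈ 𝒦, ¬ P.IsEigenvalueM α ψ lam) :
    (∀ lam ∈ 𝒦, ∃! μ, P.IsWeylValue ψ (θ lam) (φ lam) μ) ∧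
    (∀ᶠ n in l, ∀ lam ∈ 𝒦, ¬ P.IsEigenvalueReg α ψ (bn n) lam ∧
      ∃! μ, IsRegWeylValue ψ (θ lam) (φ lam) (bn n) μ) ∧
    TendstoUniformlyOn mn m l 𝒦 := by
  have hθφ lam := isFundamentalSystem_of_apply_left (hθ lam).1 (hφ lam).1 (hθ lam).2 (hφ lam).2
  have hP : P.UniformLimitCircle := (hθφ lam₁).uniformLimitCircle (hlam₁ _ (hθ lam₁).1)
    (hlam₁ _ (hφ lam₁).1)
  have hne : ∀ lam ∈ 𝒦, P.wronskianAtEnd (φ lam) ψ ≠ 0 := fun lam hlam hzero =>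
    h𝒦_eig lam hlam
      (hP.isEigenvalueM_of_wronskianAtEnd_eq_zero (hφ lam).1 (hφ lam).2 hψ hzero)
  have hweyl lam (hlam : lam ∈ 𝒦) :=
    hP.isWeylValue_iff (hθ lam).1 (hφ lam).1 hψ (hne lam hlam)
  have hne_reg : ∀ᶠ n in l, ∀ lam ∈ 𝒦, wronskian (φ lam) ψ (bn n) ≠ 0 :=
    hbn.eventually (eventually_forall_ne_zero_of_tendstoUniformlyOn
      (hP.tendstoUniformlyOn_wronskian h𝒦.isBounded hφ hψ) h𝒦 (fun lam _ =>
        (hP.continuousAt_wronskianAtEnd (hθφ lam) hφ hψ).continuousWithinAt) hne)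
  have hnot_eig : ∀ᶠ n in l, ∀ lam ∈ 𝒦, ¬ P.IsEigenvalueReg α ψ (bn n) lam := by
    filter_upwards [hne_reg, hbn.eventually (eventually_atEnd_mem left_mem_I)]
      with n hn hbnI lam hlam heig
    exact hn lam hlam
      ((hθφ lam).wronskian_eq_zero_of_isEigenvalueReg (hφ lam).2 hbnI.1 heig)
  refine ⟨fun lam hlam => by simp only [hweyl lam hlam, existsUnique_eq], ?_, ?_⟩
  · filter_upwards [hne_reg, hnot_eig] with n hn hn_eig lam hlam
    exact ⟨hn_eig lam hlam, by simp only [isRegWeylValue_iff (hn lam hlam), existsUnique_eq]⟩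
  · refine TendstoUniformlyOn.congr_right (TendstoUniformlyOn.congr (F := fun n lam =>
      -(wronskian (θ lam) ψ (bn n) / wronskian (φ lam) ψ (bn n))) (fun u hu => hbn.eventually
        (hP.tendstoUniformlyOn_wronskian_div hθ hφ hθφ hψ h𝒦 hne u hu)) ?_) fun lam hlam =>
          ((hweyl lam hlam _).1 (hm lam (h𝒦_eig lam hlam))).symm
    filter_upwards [hne_reg, hnot_eig, hmn] with n hn hn_eig hn_weyl lam hlam
    exact ((isRegWeylValue_iff (hn lam hlam) _).1 (hn_weyl lam (hn_eig lam hlam))).symm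

theorem mainTheorem7 (P : SturmLiouville)
    (α : ℂ) (η : ℝ) (K : ℂ) (hS : P.AdmissibleAt α η K)
    (lam₁ : ℂ) (hlam₁ : ((lam₁ - K) * Complex.exp (Complex.I * η)).re ≤ 0)
    (hcase : P.SimsCaseII η K lam₁ ∨ P.SimsCaseIII η K lam₁)
    (θ φ : ℂ → ℝ → ℂ × ℂ)
    (hθ : ∀ lam, P.IsSolution lam (θ lam) ∧ θ lam P.a = (Complex.cos α, Complex.sin α))
    (hφ : ∀ lam, P.IsSolution lam (φ lam) ∧ φ lam P.a = (Complex.sin α, -Complex.cos α))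
    (lam' : ℂ) (hlam' : ((lam' - K) * Complex.exp (Complex.I * η)).re ≤ 0)
    (m : ℂ → ℂ) (ψ : ℝ → ℂ × ℂ) (hψ : ψ = θ lam' + m lam' • φ lam')
    (hm : ∀ lam, ¬ P.IsEigenvalueM α ψ lam → P.IsWeylValue ψ (θ lam) (φ lam) (m lam))
    (bn : ℕ → ℝ) (hbn_mono : Monotone bn) (hbn : ∀ n, P.a < bn n ∧ (bn n : EReal) < P.b)
    (hbn_lim : Tendsto (fun n => (bn n : EReal)) atTop (𝓝 P.b))
    (mn : ℕ → ℂ → ℂ)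
    (hmn : ∀ n lam, ¬ P.IsEigenvalueReg α ψ (bn n) lam →
      IsRegWeylValue ψ (θ lam) (φ lam) (bn n) (mn n lam))
    (𝒦 : Set ℂ) (h𝒦 : IsCompact 𝒦) (h𝒦_eig : ∀ lam ∈ 𝒦, ¬ P.IsEigenvalueM α ψ lam) :
    (∀ lam ∈ 𝒦, ∃! μ, P.IsWeylValue ψ (θ lam) (φ lam) μ) ∧
    (∀ᶠ n in atTop, ∀ lam ∈ 𝒦, ¬ P.IsEigenvalueReg α ψ (bn n) lam ∧
      ∃! μ, IsRegWeylValue ψ (θ lam) (φ lam) (bn n) μ) ∧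
    TendstoUniformlyOn mn m atTop 𝒦 := by
  have hlam₁_l2w : ∀ Y, P.IsSolution lam₁ Y → P.L2w P.I fun x => (Y x).1 :=
    hcase.elim (fun h => h.2) fun h Y hY => (h Y hY).1
  exact mainTheorem7_general P α lam₁ hlam₁_l2w θ φ hθ hφ lam' ψ
    (hψ ▸ (hθ lam').1.add_smul (hφ lam').1 _) m hm bn (tendsto_atEnd (fun n => (hbn n).2) hbn_lim)
    mn (Eventually.of_forall hmn) 𝒦 h𝒦 h𝒦_eig
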